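/- Let $\Omega=\{0,1\}^{\mathbb N}$ and $\hat\Omega=\Omega\times\Omega$ carry their Borel $\sigma$-algebras, and write points of $\hat\Omega$ as $(y|x)=(\dots,y_2,y_1\,|\,x_1,x_2,\dots)$. Let $\sigma(x_1,x_2,\dots)=(x_2,x_3,\dots)$ and $\hat\sigma(\dots,y_2,y_1|x_1,x_2,\dots)=(\dots,y_2,y_1,x_1|x_2,\dots)$ be the unilateral and the bilateral shift, and let $\mathcal M(\sigma)$ and $\mathcal M(\hat\sigma)$ be the sets of $\sigma$-invariant Borel probability measures on $\Omega$ and of $\hat\sigma$-invariant Borel probability measures on $\hat\Omega$. For symbols $a_i,b_j\in\{0,1\}$ ($n,m\ge 0$) put $$\langle a_n\dots a_1|b_1\dots b_m\rangle=\{(y|x)\in\hat\Omega:\ y_i=a_i\ (1\le i\le n),\ x_j=b_j\ (1\le j\le m)\},\qquad [c_1\dots c_k]=\{x\in\Omega:\ x_i=c_i\ (1\le i\le k)\}.$$ Then for every $\mu\in\mathcal M(\sigma)$ there is exactly one $\hat\mu\in\mathcal M(\hat\sigma)$, the extension of $\mu$, such that $$\hat\mu(\langle a_n\dots a_1|b_1\dots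 b_m\rangle)=\mu([a_n\dots a_1b_1\dots b_m])\quad\text{for all words } a_n\dots a_1,\ b_1\dots b_m .$$ The map $\mu\mapsto\hat\mu$ is a bijection from $\mathcal M(\sigma)$ onto $\mathcal M(\hat\sigma)$, and its inverse sends $\nu\in\mathcal M(\hat\sigma)$ to its restriction to $\Omega$, the measure $B\mapsto\nu(\{(y|x):x\in B\})$. The map preserves Kolmogorov–Sinai entropy: $h_{\hat\mu}(\hat\sigma)=h_\mu(\sigma)$ for every $\mu\in\mathcal M(\sigma)$. Here $h_\mu(T)=\sup_{\mathcal P}\lim_{n\to\infty}\frac1n H_\mu\big(\bigvee_{j=0}^{n-1}T^{-j}\mathcal P\big)$, the supremum being over finite measurable partitions, and $H_\mu(\mathcal Q)=-\sum_{C\in\mathcal Q}\mu(C)\log\mu(C)$. -/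

import Mathlib

open MeasureTheory Filter

noncomputable section

/-- The one-sided shift space `Ω = {0,1}^ℕ` with its product (equivalently, Borel) σ-algebra.
The coordinate `x n` is the symbol written `x_{n+1}` when indices start at `1`. -/
abbrev OneSided : Type := ℕ → Fin 2

/-- The two-sided space `Ω̂ = Ω⁻ × Ω`, where `Ω⁻` is identified with `Ω`: the pair `(y, x)` stands
for the point `(…, y_3, y_2, y_1 | x_1, x_2, x_3, …)`. -/
abbrev TwoSided : Type := OneSided × OneSided

/-- The measurable structure of `Ω` is its Borel σ-algebra. -/
theorem oneSided_borelSpace : BorelSpace OneSided := inferInstance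

/-- The measurable structure of `Ω̂` is its Borel σ-algebra. -/
theorem twoSided_borelSpace : BorelSpace TwoSided := inferInstance

/-- The unilateral shift `σ(x_1, x_2, …) = (x_2, x_3, …)`. -/
def unilateralShift (x : OneSided) : OneSided := fun n => x (n + 1)

/-- The symbol `a` put in front of the sequence `y`: `(a, y_1, y_2, …)`. -/
def consSymbol (a : Fin 2) (y : OneSided) : OneSided
  | 0 => a
  | n + 1 => y n

/-- The bilateral shift `σ̂(…, y_2, y_1 | x_1, x_2, …) = (…, y_2, y_1, x_1 | x_2, …)`. -/
def bilateralShift (p : TwoSided) : TwoSided :=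
  (consSymbol (p.2 0) p.1, unilateralShift p.2)

/-- The cylinder `[w_1 … w_k] ⊆ Ω` of a finite word `w` (all of `Ω` for the empty word). -/
def cylinderSet (w : List (Fin 2)) : Set OneSided :=
  {x | ∀ i : Fin w.length, x i = w.get i}

/-- The cylinder `<a_n … a_1 | b_1 … b_m> ⊆ Ω̂`, where `u = [a_n, …, a_1]` and
`v = [b_1, …, b_m]`: the points `(y | x)` with `y_i = a_i` for `i ≤ n` and `x_j = b_j` for
`j ≤ m`. -/
def twoSidedCylinder (u v : List (Fin 2)) : Set TwoSided :=
  {p | p.1 ∈ cylinderSet u.reverse ∧ p.2 ∈ cylinderSet v}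

/-- The set `M(T)` of `T`-invariant probability measures. -/
def invariantProbabilities {α : Type*} [MeasurableSpace α] (T : α → α) :
    Set (ProbabilityMeasure α) :=
  {μ | MeasurePreserving T (μ : Measure α) (μ : Measure α)}

/-- `ν = μ̂` on cylinders: `ν(<a_n … a_1 | b_1 … b_m>) = μ([a_n … a_1 b_1 … b_m])` for all words. -/
def IsExtensionOf (ν : Measure TwoSided) (μ : Measure OneSided) : Prop :=
  ∀ u v : List (Fin 2), ν (twoSidedCylinder u v) = μ (cylinderSet (u ++ v))

/-- The restriction to `Ω` of a measure on `Ω̂`: `B ↦ ν {(y | x) : x ∈ B}`. -/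
def restrictionToOneSided (ν : Measure TwoSided) : Measure OneSided :=
  ν.map Prod.snd

/-- A finite measurable partition with cells indexed by `Fin k` (empty cells allowed) is given by
the measurable map `ξ : α → Fin k` that sends a point to the index of its cell. This is the map of
the joint partition `⋁_{j < n} T^{-j} ξ`, whose cells are indexed by words of length `n`. -/
def itinerary {α : Type*} (T : α → α) {k : ℕ} (ξ : α → Fin k) (n : ℕ) (x : α) : Fin n → Fin k :=
  fun j => ξ (T^[j] x)

/-- Shannon entropy `H_μ(⋁_{j < n} T^{-j} ξ) = -∑_C μ(C) log μ(C)`, natural logarithm,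
`0 log 0 = 0`. -/
def itineraryEntropy {α : Type*} [MeasurableSpace α] (μ : Measure α) (T : α → α)
    {k : ℕ} (ξ : α → Fin k) (n : ℕ) : ℝ :=
  ∑ w : Fin n → Fin k, Real.negMulLog (μ.real (itinerary T ξ n ⁻¹' {w}))

/-- The entropy `h_μ(T, ξ) = lim_n (1/n) H_μ(⋁_{j < n} T^{-j} ξ)` with respect to a partition; for
an invariant probability measure the limit exists by subadditivity, so it is this `limsup`. -/
def partitionEntropy {α : Type*} [MeasurableSpace α] (μ : Measure α) (T : α → α)
    {k : ℕ} (ξ : α → Fin k) : ENNReal :=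
  limsup (fun n : ℕ => ENNReal.ofReal (itineraryEntropy μ T ξ n / n)) atTop

/-- The Kolmogorov–Sinai entropy `h_μ(T)`: the supremum of `h_μ(T, ξ)` over all finite measurable
partitions `ξ`. -/
def kolmogorovSinaiEntropy {α : Type*} [MeasurableSpace α] (μ : Measure α) (T : α → α) : ENNReal :=
  ⨆ (k : ℕ) (ξ : α → Fin k) (_ : Measurable ξ), partitionEntropy μ T ξ

end

/-!
The whole argument rests on one family of sets: the clopen sets `A` of `Ω̂` for which some power of
the bilateral shift has a preimage `σ̂⁻ᴺ A` of the form `{(y | x) : x ∈ B}` (`finitePastClopens`).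
They form an algebra that generates the Borel σ-algebra. An invariant `ν` gives such a set the
measure `ν A = ν (σ̂⁻ᴺ A) = (ν restricted to Ω) B`, so `ν` is determined by its restriction
(`eq_of_map_snd_eq`); on cylinders this identity is the defining equation of the extension, so
extending `μ` and restricting to `μ` are the same condition (`isExtensionOf_iff_map_snd_eq`).

Existence (`exists_invariant_map_snd_eq`): let `P_N` be the image of `μ` under `x ↦ σ̂ᴺ(0 | x)`.
For `A` as above, `P_K A = μ B` for all `K ≥ N`. Probability measures on the compact space `Ω̂` form a
compact space, and clopen sets are continuity sets, so any limit point of the sequence `P_N` takes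
the value `μ B` on `A`. It is invariant because `σ̂⁻¹ A` corresponds to `σ⁻¹ B`.

Entropy (`kolmogorovSinaiEntropy_eq_map_snd`): the inequality `≥` holds because `σ` is a factor of
`σ̂`. For `≤`, let `ξ` be a finite partition of `Ω̂`. Approximation in the generating algebra shows
that `ξ ∘ σ̂ᴺ`, for `N` large, agrees with a partition `ζ` of `Ω` off a set of small measure
(`exists_partition_approx`). By invariance `ξ ∘ σ̂ᴺ` has the same joint entropies as `ξ`, and a
Gibbs inequality (`itineraryEntropy_le_add`) bounds those by the joint entropies of `ζ` plus a small
multiple of `n`. The limits themselves are never needed: the inequality between the joint entropies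
passes to the upper limits.
-/

/-! ### Entropy of itineraries: factors and perturbations -/

theorem measurable_itinerary {α : Type*} [MeasurableSpace α] {T : α → α} (hT : Measurable T)
    {k : ℕ} {ξ : α → Fin k} (hξ : Measurable ξ) (n : ℕ) : Measurable (itinerary T ξ n) :=
  measurable_pi_lambda _ fun j => hξ.comp (hT.iterate j)

/-- A partition pulled back along a factor map has the same joint entropies upstairs and
downstairs. The case `π = T^[N]` also expresses the invariance of the entropy under shifting the
partition. -/
theorem itineraryEntropy_comp_semiconj {α β : Type*} [MeasurableSpace α] [MeasurableSpace β]
    {ν : Measure α} {μ : Measure β} {S : α → α} {T : β → β} {π : α → β}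
    (hπ : MeasurePreserving π ν μ) (hsemi : Function.Semiconj π S T) (hT : Measurable T)
    {k : ℕ} {ξ : β → Fin k} (hξ : Measurable ξ) (n : ℕ) :
    itineraryEntropy ν S (ξ ∘ π) n = itineraryEntropy μ T ξ n := by
  have hit : itinerary S (ξ ∘ π) n = itinerary T ξ n ∘ π := by
    funext x j
    simp only [itinerary, Function.comp_apply, (hsemi.iterate_right j).eq x]
  unfold itineraryEntropy
  refine Finset.sum_congr rfl fun w _ => ?_
  rw [hit, Set.preimage_comp, measureReal_def, measureReal_def, hπ.measure_preimage
    (measurable_itinerary hT hξ n (measurableSet_singleton w)).nullMeasurableSet]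

/-- Comparison of the entropies of the two marginals of a joint law `p`, by Gibbs' inequality
against the subprobability `(i, j) ↦ p₂(j) c(i, j) exp (-K)`. -/
theorem sum_negMulLog_marginal_le {ι κ : Type*} [Fintype ι] [Fintype κ] (p c : ι → κ → ℝ)
    (hp : ∀ i j, 0 ≤ p i j) (hp1 : ∑ i, ∑ j, p i j = 1) (hc : ∀ i j, 0 < c i j) (K : ℝ)
    (hK : ∀ j, ∑ i, c i j ≤ Real.exp K) :
    ∑ i, Real.negMulLog (∑ j, p i j) ≤
      ∑ j, Real.negMulLog (∑ i, p i j) + K + ∑ i, ∑ j, p i j * -Real.log (c i j) := by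
  set r : ι → ℝ := fun i => ∑ j, p i j with hr
  set q : κ → ℝ := fun j => ∑ i, p i j with hq
  replace hp1 : ∑ i, ∑ j, p i j = 1 := hp1
  have hqnn : ∀ j, 0 ≤ q j := fun j => Finset.sum_nonneg fun i _ => hp i j
  have hpoint : ∀ i j, p i j * (Real.log (q j) + Real.log (c i j) - K - Real.log (r i)) ≤
      q j * c i j * Real.exp (-K) - p i j := by
    intro i j
    rcases (hp i j).eq_or_lt with h0 | hpos
    · rw [← h0]
      have := hqnn j
      have := (hc i j).le
      simp only [zero_mul, sub_zero]
      positivity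
    · have hle : p i j ≤ r i := Finset.single_le_sum (fun j _ => hp i j) (Finset.mem_univ j)
      have hle' : p i j ≤ q j :=
        Finset.single_le_sum (f := fun i => p i j) (fun i _ => hp i j) (Finset.mem_univ i)
      have hri : 0 < r i := hpos.trans_le hle
      have hqj : 0 < q j := hpos.trans_le hle'
      have hcij := hc i j
      have hlog : Real.log (q j) + Real.log (c i j) - K - Real.log (r i) =
          Real.log (q j * c i j * Real.exp (-K) / r i) := by
        rw [Real.log_div (by positivity) hri.ne', Real.log_mul (by positivity) (by positivity),
          Real.log_mul hqj.ne' hcij.ne', Real.log_exp]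
        ring
      rw [hlog]
      calc p i j * Real.log (q j * c i j * Real.exp (-K) / r i)
          ≤ p i j * (q j * c i j * Real.exp (-K) / r i - 1) := by
            gcongr
            exact Real.log_le_sub_one_of_pos (by positivity)
        _ = (p i j / r i) * (q j * c i j * Real.exp (-K)) - p i j := by ring
        _ ≤ 1 * (q j * c i j * Real.exp (-K)) - p i j := by
            gcongr
            exact (div_le_one hri).2 hle
        _ = _ := by ring
  have hq1 : ∑ j, q j = 1 := by rw [hq, Finset.sum_comm, hp1]
  have htotal : ∑ i, ∑ j, (q j * c i j * Real.exp (-K) - p i j) ≤ 0 := by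
    simp only [Finset.sum_sub_distrib, hp1]
    have : ∑ i, ∑ j, q j * c i j * Real.exp (-K) ≤ ∑ j, q j := by
      rw [Finset.sum_comm]
      refine Finset.sum_le_sum fun j _ => ?_
      rw [← Finset.sum_mul, ← Finset.mul_sum, mul_assoc]
      refine mul_le_of_le_one_right (hqnn j) ?_
      calc (∑ i, c i j) * Real.exp (-K) ≤ Real.exp K * Real.exp (-K) := by
            gcongr
            exact hK j
        _ = 1 := by rw [← Real.exp_add]; simp
    linarith
  have hsum := (Finset.sum_le_sum fun i (_ : i ∈ Finset.univ) =>
    Finset.sum_le_sum fun j (_ : j ∈ Finset.univ) => hpoint i j).trans htotal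
  have e1 : ∑ i, ∑ j, p i j * Real.log (r i) = -∑ i, Real.negMulLog (r i) := by
    simp only [← Finset.sum_mul, Real.negMulLog, neg_mul, Finset.sum_neg_distrib, neg_neg, hr]
  have e2 : ∑ i, ∑ j, p i j * Real.log (q j) = -∑ j, Real.negMulLog (q j) := by
    rw [Finset.sum_comm]
    simp only [← Finset.sum_mul, Real.negMulLog, neg_mul, Finset.sum_neg_distrib, neg_neg, hq]
  have e3 : ∑ i, ∑ j, p i j * K = K := by
    simp only [← Finset.sum_mul, hp1, one_mul]
  simp only [mul_sub, mul_add, Finset.sum_sub_distrib, Finset.sum_add_distrib, e1, e2, e3] at hsum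
  simp only [mul_neg, Finset.sum_neg_distrib]
  linarith

/-- If `ξ` and `η` differ on a set of measure `ε`, the joint entropy of `ξ` exceeds that of `η` by
at most `n (k δ - ε log δ)`: given the word of `η`, each symbol of `ξ` is guessed with the weight `1`
if it agrees with that of `η` and with the weight `δ` otherwise. -/
theorem itineraryEntropy_le_add {α : Type*} [MeasurableSpace α] {μ : Measure α}
    [IsProbabilityMeasure μ] {T : α → α} (hT : MeasurePreserving T μ μ) {k : ℕ}
    {ξ η : α → Fin k} (hξ : Measurable ξ) (hη : Measurable η) {δ : ℝ} (hδ : 0 < δ) (n : ℕ) :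
    itineraryEntropy μ T ξ n ≤ itineraryEntropy μ T η n +
      n * (k * δ + μ.real {x | ξ x ≠ η x} * -Real.log δ) := by
  classical
  set X := itinerary T ξ n with hX
  set Y := itinerary T η n with hY
  have hXm : Measurable X := measurable_itinerary hT.measurable hξ n
  have hYm : Measurable Y := measurable_itinerary hT.measurable hη n
  set Z : α → (Fin n → Fin k) × (Fin n → Fin k) := fun x => (X x, Y x) with hZ
  have hZm : Measurable Z := hXm.prodMk hYm
  set p : (Fin n → Fin k) → (Fin n → Fin k) → ℝ := fun i j => μ.real (Z ⁻¹' {(i, j)}) with hpdef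
  have hsum : ∀ s : Finset ((Fin n → Fin k) × (Fin n → Fin k)),
      ∑ z ∈ s, p z.1 z.2 = μ.real (Z ⁻¹' s) := fun s =>
    sum_measureReal_preimage_singleton s fun z _ => hZm (measurableSet_singleton z)
  have hrow : ∀ i, ∑ j, p i j = μ.real (X ⁻¹' {i}) := by
    intro i
    have := hsum ({i} ×ˢ Finset.univ)
    rw [Finset.sum_product, Finset.sum_singleton] at this
    rw [this]
    congr 1
    ext x
    simp [hZ, eq_comm]
  have hcol : ∀ j, ∑ i, p i j = μ.real (Y ⁻¹' {j}) := by
    intro j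
    have := hsum (Finset.univ ×ˢ {j})
    rw [Finset.sum_product] at this
    simp only [Finset.sum_singleton] at this
    rw [this]
    congr 1
    ext x
    simp [hZ, eq_comm]
  have htot : ∑ i, ∑ j, p i j = 1 := by
    have := hsum Finset.univ
    rw [← Finset.univ_product_univ, Finset.sum_product] at this
    rw [this]
    simp
  set c : (Fin n → Fin k) → (Fin n → Fin k) → ℝ :=
    fun i j => ∏ l, if i l = j l then 1 else δ with hcdef
  have hcfac : ∀ a b : Fin k, 0 < (if a = b then 1 else δ) := fun a b => by
    split_ifs <;> linarith
  have hcpos : ∀ i j, 0 < c i j := fun i j => Finset.prod_pos fun l _ => hcfac _ _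
  have hK : ∀ j, ∑ i, c i j ≤ Real.exp (n * (k * δ)) := by
    intro j
    have h1 : ∑ i, c i j = ∏ l : Fin n, ∑ a : Fin k, if a = j l then 1 else δ := by
      rw [Finset.prod_univ_sum, Fintype.piFinset_univ]
    rw [h1, Real.exp_nat_mul]
    calc ∏ l : Fin n, ∑ a : Fin k, (if a = j l then 1 else δ)
        ≤ ∏ _l : Fin n, Real.exp (k * δ) := by
          refine Finset.prod_le_prod (fun l _ => Finset.sum_nonneg fun a _ => (hcfac _ _).le)
            fun l _ => ?_
          calc ∑ a : Fin k, (if a = j l then 1 else δ)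
              ≤ ∑ a : Fin k, ((if a = j l then 1 else 0) + δ) := by
                refine Finset.sum_le_sum fun a _ => ?_
                split_ifs <;> linarith
            _ = k * δ + 1 := by
                rw [Finset.sum_add_distrib]
                simp [add_comm]
            _ ≤ Real.exp (k * δ) := Real.add_one_le_exp _
      _ = Real.exp (k * δ) ^ n := by simp
  have hlog : ∀ i j, -Real.log (c i j) = ∑ l, if i l ≠ j l then -Real.log δ else 0 := by
    intro i j
    rw [hcdef]
    simp only
    rw [Real.log_prod (fun l _ => (hcfac _ _).ne'), ← Finset.sum_neg_distrib]
    refine Finset.sum_congr rfl fun l _ => ?_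
    by_cases h : i l = j l <;> simp [h]
  have hmis : ∀ l : Fin n, ∑ i, ∑ j, p i j * (if i l ≠ j l then -Real.log δ else 0) =
      μ.real {x | ξ x ≠ η x} * -Real.log δ := by
    intro l
    have h1 := hsum (Finset.univ.filter fun z => z.1 l ≠ z.2 l)
    rw [Finset.sum_filter, ← Finset.univ_product_univ, Finset.sum_product] at h1
    have h2 : Z ⁻¹' ↑(Finset.univ.filter fun z : (Fin n → Fin k) × (Fin n → Fin k) => z.1 l ≠ z.2 l) =
        T^[l] ⁻¹' {x | ξ x ≠ η x} := by
      ext x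
      simp [hZ, hX, hY, itinerary]
    have hmeas : MeasurableSet {x | ξ x ≠ η x} := (measurableSet_eq_fun hξ hη).compl
    rw [Finset.univ_product_univ, h2, measureReal_def,
      (hT.iterate l).measure_preimage hmeas.nullMeasurableSet, ← measureReal_def] at h1
    rw [← h1, Finset.sum_mul]
    refine Finset.sum_congr rfl fun i _ => ?_
    rw [Finset.sum_mul]
    refine Finset.sum_congr rfl fun j _ => ?_
    simp only [mul_ite, mul_zero, ite_mul, zero_mul]
  have hcost : ∑ i, ∑ j, p i j * -Real.log (c i j) =
      n * (μ.real {x | ξ x ≠ η x} * -Real.log δ) := by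
    simp only [hlog, Finset.mul_sum]
    have : ∀ i, ∑ j, ∑ l, p i j * (if i l ≠ j l then -Real.log δ else 0) =
        ∑ l, ∑ j, p i j * (if i l ≠ j l then -Real.log δ else 0) := fun i => Finset.sum_comm
    rw [Finset.sum_congr rfl fun i _ => this i, Finset.sum_comm, Finset.sum_congr rfl
      fun l _ => hmis l]
    simp
  have hmain := sum_negMulLog_marginal_le p c (fun i j => measureReal_nonneg) htot hcpos _ hK
  simp only [hrow, hcol, hcost] at hmain
  unfold itineraryEntropy
  rw [mul_add, ← add_assoc]
  exact hmain

theorem partitionEntropy_le_add {α β : Type*} [MeasurableSpace α] [MeasurableSpace β]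
    {ν : Measure α} {μ : Measure β} {S : α → α} {T : β → β} {k l : ℕ}
    {ξ : α → Fin k} {ζ : β → Fin l} {r : ℝ} (hr : 0 ≤ r)
    (h : ∀ n : ℕ, itineraryEntropy ν S ξ n ≤ itineraryEntropy μ T ζ n + n * r) :
    partitionEntropy ν S ξ ≤ partitionEntropy μ T ζ + ENNReal.ofReal r := by
  have hpoint : ∀ n : ℕ, ENNReal.ofReal (itineraryEntropy ν S ξ n / n) ≤
      ENNReal.ofReal (itineraryEntropy μ T ζ n / n) + ENNReal.ofReal r := by
    intro n
    refine (ENNReal.ofReal_le_ofReal ?_).trans ENNReal.ofReal_add_le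
    -- for `n = 0` both quotients are `0`
    rcases Nat.eq_zero_or_pos n with rfl | hn
    · simpa using hr
    · have hn' : (0 : ℝ) < n := by exact_mod_cast hn
      rw [div_le_iff₀ hn', add_mul, div_mul_cancel₀ _ hn'.ne', mul_comm r]
      exact h n
  unfold partitionEntropy
  calc limsup (fun n : ℕ => ENNReal.ofReal (itineraryEntropy ν S ξ n / n)) atTop
      ≤ limsup (fun n : ℕ => ENNReal.ofReal (itineraryEntropy μ T ζ n / n) + ENNReal.ofReal r)
          atTop := limsup_le_limsup (Eventually.of_forall hpoint)
    _ = _ := limsup_add_const atTop _ _ (by isBoundedDefault) (by isBoundedDefault)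

/-! ### The two shifts -/

theorem continuous_unilateralShift : Continuous unilateralShift :=
  continuous_pi fun n => continuous_apply (n + 1)

theorem continuous_bilateralShift : Continuous bilateralShift := by
  refine Continuous.prodMk (continuous_pi fun n => ?_)
    (continuous_unilateralShift.comp continuous_snd)
  cases n with
  | zero => exact (continuous_apply 0).comp continuous_snd
  | succ n => exact (continuous_apply n).comp continuous_fst

theorem semiconj_snd_shift : Function.Semiconj Prod.snd bilateralShift unilateralShift :=
  fun _ => rfl

/-- After `i + 1` shifts, what was the first symbol of the future has index `i` in the past. -/
theorem bilateralShift_iterate_fst (i : ℕ) (p : TwoSided) :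
    (bilateralShift^[i + 1] p).1 i = p.2 0 := by
  induction i with
  | zero => rfl
  | succ i ih =>
    rw [Function.iterate_succ_apply']
    exact ih

/-! ### Clopen sets that a power of the shift carries into the one-sided space -/

/-- The clopen sets of `Ω̂` that involve only finitely many symbols of the past (and any number of
symbols of the future). This is encoded by the existence of a power of the bilateral shift under
which the preimage depends on the future alone. -/
def finitePastClopens : Set (Set TwoSided) :=
  {A | IsClopen A ∧ ∃ (N : ℕ) (B : Set OneSided), MeasurableSet B ∧
    bilateralShift^[N] ⁻¹' A = Prod.snd ⁻¹' B}

theorem preimage_iterate_add {A : Set TwoSided} {N : ℕ} {B : Set OneSided}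
    (h : bilateralShift^[N] ⁻¹' A = Prod.snd ⁻¹' B) (M : ℕ) :
    bilateralShift^[N + M] ⁻¹' A = Prod.snd ⁻¹' (unilateralShift^[M] ⁻¹' B) := by
  rw [Function.iterate_add, Set.preimage_comp, h, ← Set.preimage_comp, ← Set.preimage_comp,
    (semiconj_snd_shift.iterate_right M).comp_eq]

theorem exists_preimage_of_le {A : Set TwoSided} {N M : ℕ} (hNM : N ≤ M) {B : Set OneSided}
    (hB : MeasurableSet B) (h : bilateralShift^[N] ⁻¹' A = Prod.snd ⁻¹' B) :
    ∃ C : Set OneSided, MeasurableSet C ∧ bilateralShift^[M] ⁻¹' A = Prod.snd ⁻¹' C := by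
  obtain ⟨d, rfl⟩ := Nat.exists_eq_add_of_le hNM
  exact ⟨_, continuous_unilateralShift.measurable.iterate d hB, preimage_iterate_add h d⟩

theorem isSetAlgebra_finitePastClopens : IsSetAlgebra finitePastClopens where
  empty_mem := ⟨isClopen_empty, 0, ∅, MeasurableSet.empty, by simp⟩
  compl_mem := by
    rintro A ⟨hA, N, B, hB, h⟩
    exact ⟨hA.compl, N, Bᶜ, hB.compl, by rw [Set.preimage_compl, h, Set.preimage_compl]⟩
  union_mem := by
    rintro A A' ⟨hA, N, B, hB, h⟩ ⟨hA', N', B', hB', h'⟩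
    obtain ⟨C, hC, e⟩ := exists_preimage_of_le (le_max_left N N') hB h
    obtain ⟨C', hC', e'⟩ := exists_preimage_of_le (le_max_right N N') hB' h'
    exact ⟨hA.union hA', max N N', C ∪ C', hC.union hC',
      by rw [Set.preimage_union, e, e', Set.preimage_union]⟩

theorem preimage_snd_mem_finitePastClopens {B : Set OneSided} (hB : IsClopen B) :
    Prod.snd ⁻¹' B ∈ finitePastClopens :=
  ⟨hB.preimage continuous_snd, 0, B, hB.isOpen.measurableSet, rfl⟩

theorem generateFrom_finitePastClopens :
    (inferInstance : MeasurableSpace TwoSided) =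
      MeasurableSpace.generateFrom finitePastClopens := by
  refine le_antisymm ?_ (MeasurableSpace.generateFrom_le fun A hA => hA.1.isOpen.measurableSet)
  refine sup_le ?_ ?_
  · refine Measurable.comap_le (m₁ := MeasurableSpace.generateFrom finitePastClopens) ?_
    refine @measurable_pi_lambda _ _ _ (MeasurableSpace.generateFrom finitePastClopens) _ _
      fun i => ?_
    refine @measurable_to_countable' _ _ _ _ (MeasurableSpace.generateFrom finitePastClopens) _
      fun a => ?_
    refine MeasurableSpace.measurableSet_generateFrom
      ⟨(isClopen_discrete {a}).preimage ((continuous_apply i).comp continuous_fst),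
        i + 1, (fun x => x 0) ⁻¹' {a}, measurable_pi_apply 0 (measurableSet_singleton a), ?_⟩
    ext p
    change (bilateralShift^[i + 1] p).1 i = a ↔ p.2 0 = a
    rw [bilateralShift_iterate_fst]
  · refine Measurable.comap_le (m₁ := MeasurableSpace.generateFrom finitePastClopens) ?_
    refine @measurable_pi_lambda _ _ _ (MeasurableSpace.generateFrom finitePastClopens) _ _
      fun i => ?_
    refine @measurable_to_countable' _ _ _ _ (MeasurableSpace.generateFrom finitePastClopens) _
      fun a => ?_
    exact MeasurableSpace.measurableSet_generateFrom
      (preimage_snd_mem_finitePastClopens ((isClopen_discrete {a}).preimage (continuous_apply i)))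

theorem isPiSystem_finitePastClopens : IsPiSystem finitePastClopens :=
  isSetAlgebra_finitePastClopens.isSetRing.isSetSemiring.isPiSystem

/-! ### Uniqueness and existence of the extension -/

/-- An invariant measure on `Ω̂` is determined by its restriction to `Ω`. -/
theorem eq_of_map_snd_eq {ν ν' : Measure TwoSided} [IsProbabilityMeasure ν]
    [IsProbabilityMeasure ν'] (hν : MeasurePreserving bilateralShift ν ν)
    (hν' : MeasurePreserving bilateralShift ν' ν')
    (h : ν.map Prod.snd = ν'.map Prod.snd) : ν = ν' := by
  refine ext_of_generate_finite finitePastClopens generateFrom_finitePastClopens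
    isPiSystem_finitePastClopens ?_ (by simp)
  rintro A ⟨hA, N, B, hB, hAB⟩
  rw [← (hν.iterate N).measure_preimage hA.isOpen.measurableSet.nullMeasurableSet,
    ← (hν'.iterate N).measure_preimage hA.isOpen.measurableSet.nullMeasurableSet, hAB,
    ← Measure.map_apply measurable_snd hB, ← Measure.map_apply measurable_snd hB, h]

/-- Every invariant measure on `Ω` is the restriction of an invariant measure on `Ω̂`, obtained as a
limit point, in the compact space of probability measures, of the shifted images of `μ`. -/
theorem exists_invariant_map_snd_eq {μ : Measure OneSided} [IsProbabilityMeasure μ]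
    (hμ : MeasurePreserving unilateralShift μ μ) :
    ∃ ν : ProbabilityMeasure TwoSided,
      MeasurePreserving bilateralShift (ν : Measure TwoSided) (ν : Measure TwoSided) ∧
        (ν : Measure TwoSided).map Prod.snd = μ := by
  -- the past is filled with zeros and then overwritten by the shift; the measures obtained in
  -- this way are eventually constant on each set of the generating algebra
  set φ : ℕ → OneSided → TwoSided := fun N x => bilateralShift^[N] (0, x) with hφ
  have hφm : ∀ N, Measurable (φ N) := fun N =>
    (continuous_bilateralShift.measurable.iterate N).comp measurable_prodMk_left
  set P : ℕ → ProbabilityMeasure TwoSided := fun N =>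
    ⟨μ.map (φ N), Measure.isProbabilityMeasure_map (hφm N).aemeasurable⟩ with hP
  have hPA : ∀ {A : Set TwoSided} {N : ℕ} {B : Set OneSided}, MeasurableSet A → MeasurableSet B →
      bilateralShift^[N] ⁻¹' A = Prod.snd ⁻¹' B → ∀ K, N ≤ K →
      (P K : Measure TwoSided) A = μ B := by
    intro A N B hA hB h K hK
    obtain ⟨M, rfl⟩ := Nat.exists_eq_add_of_le hK
    have h1 : φ (N + M) ⁻¹' A = unilateralShift^[M] ⁻¹' B := by
      change (fun x => (0, x)) ⁻¹' (bilateralShift^[N + M] ⁻¹' A) = _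
      rw [preimage_iterate_add h M]
      rfl
    change μ.map (φ (N + M)) A = _
    rw [Measure.map_apply (hφm _) hA, h1, (hμ.iterate M).measure_preimage hB.nullMeasurableSet]
  set F : Ultrafilter (ProbabilityMeasure TwoSided) := (hyperfilter ℕ).map P with hF
  have hlim : Tendsto P (hyperfilter ℕ : Filter ℕ) (nhds F.lim) := F.le_nhds_lim
  have hνA : ∀ {A : Set TwoSided} {N : ℕ} {B : Set OneSided}, IsClopen A → MeasurableSet B →
      bilateralShift^[N] ⁻¹' A = Prod.snd ⁻¹' B → (F.lim : Measure TwoSided) A = μ B := by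
    intro A N B hA hB h
    have h1 := ProbabilityMeasure.tendsto_measure_of_null_frontier_of_tendsto' hlim (E := A)
      (by simp [hA.frontier_eq])
    have hev : ∀ᶠ K in (hyperfilter ℕ : Filter ℕ), (P K : Measure TwoSided) A = μ B :=
      Nat.hyperfilter_le_atTop ((eventually_ge_atTop N).mono fun K hK =>
        hPA hA.isOpen.measurableSet hB h K hK)
    exact tendsto_nhds_unique (h1.congr' hev) tendsto_const_nhds
  refine ⟨F.lim, ⟨continuous_bilateralShift.measurable, ?_⟩, ?_⟩
  · have := Measure.isProbabilityMeasure_map (μ := (F.lim : Measure TwoSided))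
      continuous_bilateralShift.measurable.aemeasurable
    refine ext_of_generate_finite finitePastClopens generateFrom_finitePastClopens
      isPiSystem_finitePastClopens ?_ (by simp)
    rintro A ⟨hA, N, B, hB, h⟩
    have h1 : bilateralShift^[N] ⁻¹' (bilateralShift ⁻¹' A) =
        Prod.snd ⁻¹' (unilateralShift ⁻¹' B) := by
      rw [← Set.preimage_comp, ← Function.iterate_succ']
      exact preimage_iterate_add h 1
    rw [Measure.map_apply continuous_bilateralShift.measurable hA.isOpen.measurableSet, hνA hA hB h,
      hνA (hA.preimage continuous_bilateralShift) (continuous_unilateralShift.measurable hB) h1,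
      hμ.measure_preimage hB.nullMeasurableSet]
  · have h1 := (ProbabilityMeasure.continuous_map (Ω := TwoSided) (Ω' := OneSided)
      continuous_snd).tendsto F.lim |>.comp hlim
    have h2 : ∀ K, (P K).map (measurable_snd.aemeasurable) =
        (⟨μ, inferInstance⟩ : ProbabilityMeasure OneSided) := by
      intro K
      apply Subtype.ext
      change (μ.map (φ K)).map Prod.snd = μ
      rw [Measure.map_map measurable_snd (hφm K)]
      have : Prod.snd ∘ φ K = unilateralShift^[K] := by
        funext x
        exact (semiconj_snd_shift.iterate_right K).eq (0, x)
      rw [this, (hμ.iterate K).map_eq]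
    have h3 := tendsto_nhds_unique h1 (tendsto_const_nhds.congr fun K => (h2 K).symm)
    exact congrArg Subtype.val h3

/-! ### Cylinders -/

theorem isPiSystem_cylinderSet : IsPiSystem (Set.range cylinderSet) := by
  have key : ∀ v w : List (Fin 2), (cylinderSet v ∩ cylinderSet w).Nonempty →
      v.length ≤ w.length → cylinderSet w ⊆ cylinderSet v := by
    rintro v w ⟨z, hv, hw⟩ hlen x hx i
    have h1 := hv i
    have h2 := hw ⟨i, i.2.trans_le hlen⟩
    have h3 := hx ⟨i, i.2.trans_le hlen⟩
    exact h3.trans (h2.symm.trans h1)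
  rintro _ ⟨v, rfl⟩ _ ⟨w, rfl⟩ hne
  rcases le_total v.length w.length with h | h
  · exact ⟨w, (Set.inter_eq_right.2 (key v w hne h)).symm⟩
  · exact ⟨v, (Set.inter_eq_left.2 (key w v (Set.inter_comm _ _ ▸ hne) h)).symm⟩

theorem measurableSet_cylinderSet (w : List (Fin 2)) : MeasurableSet (cylinderSet w) := by
  have : cylinderSet w = ⋂ i : Fin w.length, (fun x : OneSided => x i) ⁻¹' {w.get i} := by
    ext x
    simp [cylinderSet]
  rw [this]
  exact MeasurableSet.iInter fun i => measurable_pi_apply _ (measurableSet_singleton _)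

theorem generateFrom_cylinderSet :
    (inferInstance : MeasurableSpace OneSided) =
      MeasurableSpace.generateFrom (Set.range cylinderSet) := by
  refine le_antisymm ?_ (MeasurableSpace.generateFrom_le ?_)
  · refine iSup_le fun i => Measurable.comap_le
      (m₁ := MeasurableSpace.generateFrom (Set.range cylinderSet)) ?_
    refine @measurable_to_countable' _ _ _ _
      (MeasurableSpace.generateFrom (Set.range cylinderSet)) _ fun a => ?_
    have : (fun x : OneSided => x i) ⁻¹' {a} =
        ⋃ w ∈ {w : List (Fin 2) | w[i]? = some a}, cylinderSet w := by
      ext x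
      simp only [Set.mem_preimage, Set.mem_singleton_iff, Set.mem_iUnion, Set.mem_ofPred_eq]
      constructor
      · rintro rfl
        refine ⟨List.ofFn fun j : Fin (i + 1) => x j, ?_, fun j => ?_⟩
        · simp [-List.ofFn_succ]
        · simp [-List.ofFn_succ]
      · rintro ⟨w, hw, hx⟩
        obtain ⟨hi, rfl⟩ := List.getElem?_eq_some_iff.1 hw
        exact hx ⟨i, hi⟩
    rw [this]
    exact MeasurableSet.biUnion (Set.to_countable _) fun w _ =>
      MeasurableSpace.measurableSet_generateFrom ⟨w, rfl⟩
  · rintro _ ⟨w, rfl⟩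
    exact measurableSet_cylinderSet w

theorem mem_cylinderSet_cons {a : Fin 2} {w : List (Fin 2)} {x : OneSided} :
    x ∈ cylinderSet (a :: w) ↔ x 0 = a ∧ unilateralShift x ∈ cylinderSet w := by
  constructor
  · intro h
    exact ⟨h ⟨0, by simp⟩, fun i => h ⟨i + 1, by simp⟩⟩
  · rintro ⟨h0, h⟩ ⟨i, hi⟩
    cases i with
    | zero => exact h0
    | succ i => exact h ⟨i, by simpa using hi⟩

theorem bilateralShift_preimage_twoSidedCylinder (u v : List (Fin 2)) (a : Fin 2) :
    bilateralShift ⁻¹' twoSidedCylinder (u ++ [a]) v = twoSidedCylinder u (a :: v) := by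
  ext p
  simp only [twoSidedCylinder, Set.mem_preimage, Set.mem_ofPred_eq, List.reverse_append,
    List.reverse_cons, List.reverse_nil, List.nil_append, List.singleton_append,
    mem_cylinderSet_cons]
  exact ⟨fun h => ⟨h.1.2, h.1.1, h.2⟩, fun h => ⟨⟨h.2.1, h.1⟩, h.2.2⟩⟩

theorem twoSidedCylinder_nil (v : List (Fin 2)) :
    twoSidedCylinder [] v = Prod.snd ⁻¹' cylinderSet v := by
  ext p
  refine ⟨fun h => h.2, fun h => ⟨fun i => ?_, h⟩⟩
  exact absurd i.2 (by simp)

theorem measurableSet_twoSidedCylinder (u v : List (Fin 2)) :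
    MeasurableSet (twoSidedCylinder u v) :=
  (measurable_fst (measurableSet_cylinderSet _)).inter (measurable_snd (measurableSet_cylinderSet _))

/-- Shifting by the length of the past word `u` turns a two-sided cylinder into a one-sided one. -/
theorem measure_twoSidedCylinder {ν : Measure TwoSided}
    (hν : MeasurePreserving bilateralShift ν ν) (u v : List (Fin 2)) :
    ν (twoSidedCylinder u v) = ν.map Prod.snd (cylinderSet (u ++ v)) := by
  induction u using List.reverseRecOn generalizing v with
  | nil =>
    rw [twoSidedCylinder_nil, Measure.map_apply measurable_snd (measurableSet_cylinderSet _)]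
    rfl
  | append_singleton u a ih =>
    rw [← hν.measure_preimage (measurableSet_twoSidedCylinder _ _).nullMeasurableSet,
      bilateralShift_preimage_twoSidedCylinder, ih]
    simp

/-- For an invariant measure, the prescription on cylinders says no more than that `μ` is the
restriction to `Ω`. -/
theorem isExtensionOf_iff_map_snd_eq {ν : Measure TwoSided} {μ : Measure OneSided}
    [IsProbabilityMeasure ν] [IsProbabilityMeasure μ]
    (hν : MeasurePreserving bilateralShift ν ν) :
    IsExtensionOf ν μ ↔ ν.map Prod.snd = μ := by
  constructor
  · intro h
    have := Measure.isProbabilityMeasure_map (μ := ν) measurable_snd.aemeasurable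
    refine ext_of_generate_finite _ generateFrom_cylinderSet isPiSystem_cylinderSet ?_ (by simp)
    rintro _ ⟨w, rfl⟩
    rw [← List.nil_append w, ← measure_twoSidedCylinder hν, h]
  · rintro rfl u v
    exact measure_twoSidedCylinder hν u v

/-! ### Equality of the entropies -/

/-- Up to a set of small measure, a power of the shift makes a finite partition of `Ω̂` depend on
the future alone. -/
theorem exists_partition_approx {ν : Measure TwoSided} [IsProbabilityMeasure ν]
    (hν : MeasurePreserving bilateralShift ν ν) {k : ℕ} {ξ : TwoSided → Fin k}
    (hξ : Measurable ξ) {ε : ℝ} (hε : 0 < ε) :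
    ∃ (N : ℕ) (ζ : OneSided → Fin k), Measurable ζ ∧
      ν.real {p | (ξ ∘ bilateralShift^[N]) p ≠ (ζ ∘ Prod.snd) p} ≤ k * ε := by
  have hne : Nonempty (Fin k) := ⟨ξ (0, 0)⟩
  have happ : ∀ i : Fin k, ∃ A ∈ finitePastClopens,
      ν (symmDiff A (ξ ⁻¹' {i})) < ENNReal.ofReal ε := fun i =>
    exists_measure_symmDiff_lt_of_generateFrom_isSetRing
      isSetAlgebra_finitePastClopens.isSetRing
      ⟨{Set.univ}, Set.countable_singleton _,
        Set.singleton_subset_iff.2 isSetAlgebra_finitePastClopens.univ_mem, by simp⟩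
      generateFrom_finitePastClopens (hξ (measurableSet_singleton i)) (ENNReal.ofReal_pos.2 hε)
  choose A hA hAε using happ
  choose hAc n B₀ hB₀ hAB₀ using hA
  set N := Finset.univ.sup n with hN
  choose B hB hAB using fun i => exists_preimage_of_le
    (Finset.le_sup (f := n) (Finset.mem_univ i)) (hB₀ i) (hAB₀ i)
  -- a point is sent to some index `i` with `x ∈ B i`; off the exceptional set there is only one
  refine ⟨N, fun x => Classical.epsilon fun i => x ∈ B i, ?_, ?_⟩
  · have h1 : Measurable fun (x : OneSided) (i : Fin k) => x ∈ B i :=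
      measurable_pi_lambda _ fun i => measurable_mem.2 (hB i)
    have h2 : Measurable fun b : Fin k → Prop => Classical.epsilon b := measurable_of_countable _
    exact h2.comp h1
  · have hsub : {p : TwoSided | (ξ ∘ bilateralShift^[N]) p ≠
          ((fun x => Classical.epsilon fun i => x ∈ B i) ∘ Prod.snd) p} ⊆
        ⋃ i, bilateralShift^[N] ⁻¹' symmDiff (A i) (ξ ⁻¹' {i}) := by
      intro p hp
      by_contra hcon
      refine hp ?_
      have hiff : ∀ i, p.2 ∈ B i ↔ ξ (bilateralShift^[N] p) = i := by
        intro i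
        have h1 : p.2 ∈ B i ↔ bilateralShift^[N] p ∈ A i := by
          change p ∈ Prod.snd ⁻¹' B i ↔ p ∈ bilateralShift^[N] ⁻¹' A i
          rw [hAB i]
        have h2 : bilateralShift^[N] p ∉ symmDiff (A i) (ξ ⁻¹' {i}) := fun h =>
          hcon (Set.mem_iUnion.2 ⟨i, h⟩)
        rw [Set.mem_symmDiff] at h2
        rw [h1]
        simp only [Set.mem_preimage, Set.mem_singleton_iff] at h2
        tauto
      exact (hiff _).1 (Classical.epsilon_spec (p := fun i => p.2 ∈ B i) ⟨_, (hiff _).2 rfl⟩)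
    calc ν.real _ ≤ ν.real (⋃ i, bilateralShift^[N] ⁻¹' symmDiff (A i) (ξ ⁻¹' {i})) :=
          measureReal_mono hsub
      _ ≤ ∑ i, ν.real (bilateralShift^[N] ⁻¹' symmDiff (A i) (ξ ⁻¹' {i})) :=
          measureReal_iUnion_fintype_le _
      _ ≤ ∑ _i : Fin k, ε := by
          refine Finset.sum_le_sum fun i _ => ?_
          rw [measureReal_def, (hν.iterate N).measure_preimage
            ((hAc i).isOpen.measurableSet.symmDiff (hξ (measurableSet_singleton i))).nullMeasurableSet]
          exact ENNReal.toReal_le_of_le_ofReal hε.le (hAε i).le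
      _ = k * ε := by simp

/-- Restriction to the future preserves the entropy of an invariant measure: by invariance a
partition may be shifted until it is nearly determined by the future, at a small cost in entropy. -/
theorem kolmogorovSinaiEntropy_eq_map_snd {ν : Measure TwoSided} [IsProbabilityMeasure ν]
    (hν : MeasurePreserving bilateralShift ν ν) :
    kolmogorovSinaiEntropy ν bilateralShift =
      kolmogorovSinaiEntropy (ν.map Prod.snd) unilateralShift := by
  have hsnd : MeasurePreserving Prod.snd ν (ν.map Prod.snd) := ⟨measurable_snd, rfl⟩
  have hσ := continuous_unilateralShift.measurable
  have hfactor : ∀ {k : ℕ} {ζ : OneSided → Fin k}, Measurable ζ → ∀ n,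
      itineraryEntropy ν bilateralShift (ζ ∘ Prod.snd) n =
        itineraryEntropy (ν.map Prod.snd) unilateralShift ζ n := fun hζ n =>
    itineraryEntropy_comp_semiconj hsnd semiconj_snd_shift hσ hζ n
  refine le_antisymm ?_ ?_
  · refine iSup_le fun k => iSup_le fun ξ => iSup_le fun hξ => ?_
    refine ENNReal.le_of_forall_pos_le_add fun r hr _ => ?_
    have hr' : (0 : ℝ) < r := hr
    have hk : 0 < k := Fin.pos (ξ (0, 0))
    have hk' : (0 : ℝ) < k := by exact_mod_cast hk
    -- the weight `δ` gives `k δ ≤ r / 2`; the partitions then differ on a set of measure at most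
    -- `k ε` with `k ε log (1 / δ) = r / 2`
    set δ : ℝ := min (1 / 2) (r / (2 * k)) with hδdef
    have hδ : 0 < δ := lt_min (by norm_num) (by positivity)
    have hδ1 : δ < 1 := (min_le_left _ _).trans_lt (by norm_num)
    have hlog : 0 < -Real.log δ := neg_pos.2 (Real.log_neg hδ hδ1)
    obtain ⟨N, ζ, hζ, hζε⟩ := exists_partition_approx hν hξ
      (ε := r / (2 * k * -Real.log δ)) (by positivity)
    have hbound : ∀ n : ℕ, itineraryEntropy ν bilateralShift ξ n ≤
        itineraryEntropy (ν.map Prod.snd) unilateralShift ζ n + n * r := by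
      intro n
      have hinv : itineraryEntropy ν bilateralShift (ξ ∘ bilateralShift^[N]) n =
          itineraryEntropy ν bilateralShift ξ n :=
        itineraryEntropy_comp_semiconj (hν.iterate N)
          (Function.Commute.iterate_self bilateralShift N) hν.measurable hξ n
      rw [← hinv, ← hfactor hζ]
      refine (itineraryEntropy_le_add hν (hξ.comp (hν.measurable.iterate N))
        (hζ.comp measurable_snd) hδ n).trans ?_
      gcongr
      have h1 : k * δ ≤ r / 2 := by
        calc (k : ℝ) * δ ≤ k * (r / (2 * k)) := by
              gcongr
              exact min_le_right _ _
          _ = r / 2 := by field_simp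
      have h2 := mul_le_mul_of_nonneg_right hζε hlog.le
      have h3 : (k : ℝ) * (r / (2 * k * -Real.log δ)) * -Real.log δ = r / 2 := by
        have hlog' := hlog.ne'
        generalize -Real.log δ = t at hlog'
        field_simp
      linarith
    refine (partitionEntropy_le_add hr'.le hbound).trans ?_
    rw [ENNReal.ofReal_coe_nnreal]
    gcongr
    exact le_iSup_of_le k (le_iSup_of_le ζ (le_iSup_of_le hζ le_rfl))
  · refine iSup_le fun k => iSup_le fun ζ => iSup_le fun hζ => ?_
    refine le_iSup_of_le k (le_iSup_of_le (ζ ∘ Prod.snd)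
      (le_iSup_of_le (hζ.comp measurable_snd) (le_of_eq ?_)))
    simp only [partitionEntropy, hfactor hζ]

/-! ### The extension map -/

theorem mainTheorem7 :
    ∃ ext : invariantProbabilities unilateralShift → invariantProbabilities bilateralShift,
      (∀ (μ : invariantProbabilities unilateralShift)
          (ν : invariantProbabilities bilateralShift),
        IsExtensionOf (ν : ProbabilityMeasure TwoSided) (μ : ProbabilityMeasure OneSided) ↔
          ext μ = ν) ∧
      Function.Bijective ext ∧
      (∀ (μ : invariantProbabilities unilateralShift)
          (ν : invariantProbabilities bilateralShift),
        ext μ = ν ↔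
          restrictionToOneSided (ν : ProbabilityMeasure TwoSided) =
            ((μ : ProbabilityMeasure OneSided) : Measure OneSided)) ∧
      ∀ μ : invariantProbabilities unilateralShift,
        kolmogorovSinaiEntropy ((ext μ : ProbabilityMeasure TwoSided) : Measure TwoSided)
            bilateralShift =
          kolmogorovSinaiEntropy ((μ : ProbabilityMeasure OneSided) : Measure OneSided)
            unilateralShift := by
  have hex : ∀ μ : invariantProbabilities unilateralShift,
      ∃ ν : invariantProbabilities bilateralShift,
        ((ν : ProbabilityMeasure TwoSided) : Measure TwoSided).map Prod.snd =
          ((μ : ProbabilityMeasure OneSided) : Measure OneSided) := fun μ =>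
    let ⟨ν, hν, h⟩ := exists_invariant_map_snd_eq μ.2
    ⟨⟨ν, hν⟩, h⟩
  choose ext hext using hex
  have hiff : ∀ (μ : invariantProbabilities unilateralShift)
      (ν : invariantProbabilities bilateralShift),
      ext μ = ν ↔ ((ν : ProbabilityMeasure TwoSided) : Measure TwoSided).map Prod.snd =
        ((μ : ProbabilityMeasure OneSided) : Measure OneSided) := by
    intro μ ν
    refine ⟨fun h => h ▸ hext μ, fun h => Subtype.ext (Subtype.ext ?_)⟩
    exact eq_of_map_snd_eq (ν := (ext μ : ProbabilityMeasure TwoSided))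
      (ν' := (ν : ProbabilityMeasure TwoSided)) (ext μ).2 ν.2 ((hext μ).trans h.symm)
  refine ⟨ext, fun μ ν => (isExtensionOf_iff_map_snd_eq ν.2).trans (hiff μ ν).symm,
    ⟨?_, ?_⟩, hiff, fun μ => ?_⟩
  · intro μ μ' h
    exact Subtype.ext (Subtype.ext (((hext μ).symm.trans (by rw [h])).trans (hext μ')))
  · intro ν
    have hinv : MeasurePreserving unilateralShift
        (((ν : ProbabilityMeasure TwoSided) : Measure TwoSided).map Prod.snd)
        (((ν : ProbabilityMeasure TwoSided) : Measure TwoSided).map Prod.snd) := by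
      refine ⟨continuous_unilateralShift.measurable, ?_⟩
      rw [Measure.map_map continuous_unilateralShift.measurable measurable_snd,
        ← semiconj_snd_shift.comp_eq, ← Measure.map_map measurable_snd
          continuous_bilateralShift.measurable, ν.2.map_eq]
    exact ⟨⟨(ν : ProbabilityMeasure TwoSided).map measurable_snd.aemeasurable, hinv⟩,
      (hiff _ ν).2 rfl⟩
  · rw [kolmogorovSinaiEntropy_eq_map_snd (ν := (ext μ : ProbabilityMeasure TwoSided)) (ext μ).2,
      hext μ]
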